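/- All groups are abelian. Let $L$ be the vocabulary with a binary function symbol $+$ and a constant symbol $0$. For infinite cardinals $\lambda\le\kappa$, $L_{\kappa\lambda}$ is the smallest collection of formulas that contains the atomic $L$-formulas and is closed under negation, under conjunctions and disjunctions of families of fewer than $\kappa$ formulas, and under existential and universal quantification over strings of variables of length less than $\lambda$; $L_{\infty\lambda}$ is the union of the $L_{\kappa\lambda}$ over all infinite cardinals $\kappa\ge\lambda$. A class $\mathbf C$ of groups is definable in such a logic if there is a sentence $\varphi$ of the logic such that, for every group $G$, $G\in\mathbf C$ if and only if $\varphi$ holds in $G$. A group $A$ is cotorsion if $\operatorname{Ext}(J,A)=0$ for every torsion-free group $J$, and a group $G$ is cotorsion-free if it has no non-zero cotorsion subgroup. **Corollary 2.2.** The class of cotorsion-free groups is $L_{(2^{\aleph_0})^+\omega}$-definable, and hence $L_{\infty\omega}$-definable. -/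

import Mathlib

open CategoryTheory

universe u' v' w u

namespace InfLogic

/-- Infinitary formulas over a vocabulary `L` with free variables indexed by `α`, built from
the atomic formulas by negation, conjunctions and disjunctions of arbitrary (set-indexed) families
and existential and universal quantification over arbitrary strings of variables. In `ex φ` and
`all φ` the string of quantified variables is indexed by `β`. -/
inductive Formula (L : FirstOrder.Language.{u', v'}) : Type w → Type (max u' v' (w + 1))
  | equal {α : Type w} (t s : L.Term α) : Formula L α
  | rel {α : Type w} {n : ℕ} (R : L.Relations n) (ts : Fin n → L.Term α) : Formula L α
  | not {α : Type w} (φ : Formula L α) : Formula L α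
  | conj {α ι : Type w} (φ : ι → Formula L α) : Formula L α
  | disj {α ι : Type w} (φ : ι → Formula L α) : Formula L α
  | ex {α β : Type w} (φ : Formula L (α ⊕ β)) : Formula L α
  | all {α β : Type w} (φ : Formula L (α ⊕ β)) : Formula L α

/-- Satisfaction of a formula in an `L`-structure `M` under an assignment of its free
variables. -/
def Formula.Realize {L : FirstOrder.Language.{u', v'}} {M : Type u} [L.Structure M] :
    ∀ {α : Type w}, Formula L α → (α → M) → Prop
  | _, .equal t s, v => t.realize v = s.realize v
  | _, .rel R ts, v => FirstOrder.Language.Structure.RelMap R (fun i => (ts i).realize v)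
  | _, .not φ, v => ¬ φ.Realize v
  | _, .conj φ, v => ∀ i, (φ i).Realize v
  | _, .disj φ, v => ∃ i, (φ i).Realize v
  | _, .ex (β := β) φ, v => ∃ x : β → M, φ.Realize (Sum.elim v x)
  | _, .all (β := β) φ, v => ∀ x : β → M, φ.Realize (Sum.elim v x)

/-- `φ.MemL κ l`: the formula `φ` belongs to `L_{κ l}`, that is, all conjunctions and disjunctions
in it are of fewer than `κ` formulas and all its quantifier strings have length less than `l`. -/
def Formula.MemL {L : FirstOrder.Language.{u', v'}} (κ l : Cardinal.{w}) :
    ∀ {α : Type w}, Formula L α → Prop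
  | _, .equal _ _ => True
  | _, .rel _ _ => True
  | _, .not φ => φ.MemL κ l
  | _, .conj (ι := ι) φ => Cardinal.mk ι < κ ∧ ∀ i, (φ i).MemL κ l
  | _, .disj (ι := ι) φ => Cardinal.mk ι < κ ∧ ∀ i, (φ i).MemL κ l
  | _, .ex (β := β) φ => Cardinal.mk β < l ∧ φ.MemL κ l
  | _, .all (β := β) φ => Cardinal.mk β < l ∧ φ.MemL κ l

/-- `L_{∞ l}` is the union of the languages `L_{κ l}` over the infinite cardinals `κ ≥ l`. -/
def Formula.MemLInfty {L : FirstOrder.Language.{u', v'}} (l : Cardinal.{w}) {α : Type w}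
    (φ : Formula L α) : Prop :=
  ∃ κ : Cardinal.{w}, Cardinal.aleph0 ≤ κ ∧ l ≤ κ ∧ φ.MemL κ l

/-- A sentence is a formula without free variables. -/
abbrev Sentence (L : FirstOrder.Language.{u', v'}) : Type (max u' v' (w + 1)) :=
  Formula L PEmpty.{w + 1}

/-- `φ.Holds M`: the sentence `φ` holds in the structure `M`. -/
def Sentence.Holds {L : FirstOrder.Language.{u', v'}} (φ : Sentence.{u', v', w} L) (M : Type u)
    [L.Structure M] : Prop :=
  Formula.Realize φ (fun x : PEmpty.{w + 1} => (x.elim : M))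

/-- The function symbols of the vocabulary of groups: a constant and a binary function symbol. -/
inductive GroupFunc : ℕ → Type
  | zero : GroupFunc 0
  | add : GroupFunc 2

/-- The vocabulary of (abelian) groups. -/
def groupLang : FirstOrder.Language.{0, 0} := ⟨GroupFunc, fun _ => Empty⟩

/-- Every abelian group is a structure for the vocabulary of groups. -/
instance groupStructure (G : Type u) [AddCommGroup G] : groupLang.Structure G where
  funMap := fun f => match f with
    | GroupFunc.zero => fun _ => 0
    | GroupFunc.add => fun x => x 0 + x 1
  RelMap := fun r => Empty.elim r

/-- A class `C` of abelian groups is `L_{κ l}`-definable if some `L_{κ l}`-sentence holds in exactly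
the abelian groups that belong to `C`. -/
def IsDefinable (κ l : Cardinal.{w}) (C : ∀ (G : Type u) [AddCommGroup G], Prop) : Prop :=
  ∃ φ : Sentence.{0, 0, w} groupLang, φ.MemL κ l ∧
    ∀ (G : Type u) [AddCommGroup G], C G ↔ φ.Holds G

/-- A class `C` of abelian groups is `L_{∞ l}`-definable if some `L_{∞ l}`-sentence holds in exactly
the abelian groups that belong to `C`. -/
def IsDefinableInfty (l : Cardinal.{w}) (C : ∀ (G : Type u) [AddCommGroup G], Prop) : Prop :=
  ∃ φ : Sentence.{0, 0, w} groupLang, φ.MemLInfty l ∧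
    ∀ (G : Type u) [AddCommGroup G], C G ↔ φ.Holds G

end InfLogic

/-- An abelian group `A` is cotorsion if `Ext(J, A) = 0` for all torsion-free abelian
groups `J`. -/
def IsCotorsion (A : Type u) [AddCommGroup A] : Prop :=
  ∀ (J : Type u) [AddCommGroup J] [IsAddTorsionFree J],
    Subsingleton (Abelian.Ext.{u} (ModuleCat.of ℤ J) (ModuleCat.of ℤ A) 1)

/-- An abelian group is cotorsion-free if it has no non-zero cotorsion subgroup. -/
def IsCotorsionFree (G : Type u) [AddCommGroup G] : Prop :=
  ∀ H : AddSubgroup G, IsCotorsion H → H = ⊥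

/-! The group `G` is cotorsion-free exactly when no `x ≠ 0` in `G` admits all profinite multiples:
for each compatible sequence `c`, some `y` with `y ≡ c n • x` modulo `n! G` for all `n`. There are
at most `2 ^ ℵ₀` sequences `c`, and each congruence is first-order, which gives the sentence.

A cotorsion group contains all profinite multiples of its elements, by
`IsCotorsion.exists_profinite_multiple`: lifting along a free presentation of `ℚ` solves the
required recursion.

Conversely, a cotorsion-free `G` is torsion-free and reduced, so the subgroups `n! G` meet in zero.
Profinite multiples of `x` are then unique, and `c ↦ c x` is a homomorphism from the compact group
of profinite integers with closed kernel. Its image contains `x` and is cotorsion, because compact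
Hausdorff groups are algebraically compact. -/

namespace InfLogic

/-! ### The defining sentence -/

variable {α : Type w} {G : Type u} [AddCommGroup G]

/-- The term `n • t`. -/
def nsmulTerm (t : groupLang.Term α) : ℕ → groupLang.Term α
  | 0 => FirstOrder.Language.Term.func (l := 0) (show groupLang.Functions 0 from GroupFunc.zero) Fin.elim0
  | n + 1 => FirstOrder.Language.Term.func (l := 2) (show groupLang.Functions 2 from GroupFunc.add) ![nsmulTerm t n, t]

/-- The term `s + t`. -/
def addTerm (s t : groupLang.Term α) : groupLang.Term α :=
  FirstOrder.Language.Term.func (l := 2) (show groupLang.Functions 2 from GroupFunc.add) ![s, t]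

lemma realize_addTerm (s t : groupLang.Term α) (v : α → G) :
    (addTerm s t).realize v = s.realize v + t.realize v := rfl

lemma realize_nsmulTerm (t : groupLang.Term α) (n : ℕ) (v : α → G) :
    (nsmulTerm t n).realize v = n • t.realize v := by
  induction n with
  | zero => exact (zero_nsmul _).symm
  | succ n ih =>
    rw [succ_nsmul, ← ih]
    rfl

/-- Implication of formulas. -/
def Formula.imp (φ ψ : Formula groupLang α) : Formula groupLang α :=
  .disj (ι := ULift.{w} Bool) fun b => cond b.down φ.not ψ

lemma Formula.realize_imp (φ ψ : Formula groupLang α) (v : α → G) :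
    (φ.imp ψ).Realize v ↔ (φ.Realize v → ψ.Realize v) := by
  simp [Formula.imp, Formula.Realize, imp_iff_not_or, or_comm]

lemma Formula.memL_imp {κ l : Cardinal.{w}} (hκ : Cardinal.aleph0 ≤ κ)
    {φ ψ : Formula groupLang α} (hφ : φ.MemL κ l) (hψ : ψ.MemL κ l) : (φ.imp ψ).MemL κ l := by
  refine ⟨(Cardinal.lt_aleph0_of_finite _).trans_le hκ, ?_⟩
  rintro ⟨_ | _⟩
  exacts [hψ, hφ]

/-- Existential quantification over one variable. -/
abbrev Formula.exOne (φ : Formula groupLang (α ⊕ PUnit.{w + 1})) : Formula groupLang α := .ex φ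

/-- Universal quantification over one variable. -/
abbrev Formula.allOne (φ : Formula groupLang (α ⊕ PUnit.{w + 1})) : Formula groupLang α := .all φ

lemma Formula.realize_exOne (φ : Formula groupLang (α ⊕ PUnit.{w + 1})) (v : α → G) :
    φ.exOne.Realize v ↔ ∃ x : G, φ.Realize (Sum.elim v fun _ => x) :=
  ⟨fun ⟨x, hx⟩ => ⟨x ⟨⟩, hx⟩, fun ⟨x, hx⟩ => ⟨fun _ => x, hx⟩⟩

lemma Formula.realize_allOne (φ : Formula groupLang (α ⊕ PUnit.{w + 1})) (v : α → G) :
    φ.allOne.Realize v ↔ ∀ x : G, φ.Realize (Sum.elim v fun _ => x) :=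
  ⟨fun h x => h fun _ => x, fun h x => h (x ⟨⟩)⟩

/-- The formula expressing that `t` is zero. -/
def Formula.isZero (t : groupLang.Term α) : Formula groupLang α := .equal t (nsmulTerm t 0)

lemma Formula.realize_isZero (t : groupLang.Term α) (v : α → G) :
    (Formula.isZero t).Realize v ↔ t.realize v = 0 := by
  simp only [isZero, Formula.Realize, realize_nsmulTerm, zero_nsmul]

/-- The formula expressing `t ∈ c • s + n • G`. -/
def Formula.congr (t s : groupLang.Term α) (c n : ℕ) : Formula groupLang α :=
  .exOne (.equal (t.relabel Sum.inl)
    (addTerm (nsmulTerm (s.relabel Sum.inl) c) (nsmulTerm (.var (Sum.inr ⟨⟩)) n)))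

lemma Formula.realize_congr (t s : groupLang.Term α) (c n : ℕ) (v : α → G) :
    (Formula.congr t s c n).Realize v ↔ ∃ z : G, t.realize v = c • s.realize v + n • z := by
  simp only [congr, realize_exOne, Formula.Realize, realize_addTerm, realize_nsmulTerm,
    FirstOrder.Language.Term.realize_relabel, Sum.elim_comp_inl,
    FirstOrder.Language.Term.realize_var, Sum.elim_inr]

/-- The sequences of natural numbers that are convergent for the topology given by the ideals
`(n!)`. -/
def CompatibleSeq : Type := {c : ℕ → ℕ // ∀ n, c (n + 1) ≡ c n [MOD n.factorial]}

/-- Only for `x = 0` do all multiples `c • x` by profinite integers `c` exist. -/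
def cotorsionFreeSentence : Sentence.{0, 0, w} groupLang :=
  .allOne <| .imp
    (.conj (ι := ULift.{w} CompatibleSeq) fun c => .exOne <| .conj (ι := ULift.{w} ℕ) fun n =>
      .congr (.var (Sum.inr ⟨⟩)) (.var (Sum.inl (Sum.inr ⟨⟩)))
        (c.down.1 n.down) n.down.factorial)
    (.isZero (.var (Sum.inr ⟨⟩)))

lemma holds_cotorsionFreeSentence : cotorsionFreeSentence.{w}.Holds G ↔
    ∀ x : G, (∀ c : CompatibleSeq, ∃ y : G, ∀ n, ∃ z : G,
      y = c.1 n • x + n.factorial • z) → x = 0 := by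
  have conj_iff {β ι : Type w} (φ : ι → Formula groupLang β) (v : β → G) :
      (Formula.conj φ).Realize v ↔ ∀ i, (φ i).Realize v := Iff.rfl
  simp only [cotorsionFreeSentence, Sentence.Holds, conj_iff, ULift.forall,
    Formula.realize_allOne, Formula.realize_imp, Formula.realize_isZero, Formula.realize_congr,
    Formula.realize_exOne, FirstOrder.Language.Term.realize_var, Sum.elim_inr, Sum.elim_inl]

lemma mk_compatibleSeq_le : Cardinal.mk CompatibleSeq ≤ 2 ^ Cardinal.aleph0.{0} := by
  refine (Cardinal.mk_subtype_le _).trans ?_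
  simp

lemma memL_cotorsionFreeSentence : cotorsionFreeSentence.{w}.MemL
    (Order.succ (2 ^ Cardinal.aleph0.{w})) Cardinal.aleph0.{w} := by
  have h0 : Cardinal.aleph0.{w} < Order.succ (2 ^ Cardinal.aleph0.{w}) :=
    (Cardinal.cantor _).trans (Order.lt_succ _)
  have hN : Cardinal.mk (ULift.{w} ℕ) < Order.succ (2 ^ Cardinal.aleph0.{w}) := by simpa using h0
  have hC : Cardinal.mk (ULift.{w} CompatibleSeq) < Order.succ (2 ^ Cardinal.aleph0.{w}) := by
    rw [Order.lt_succ_iff, Cardinal.mk_uLift]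
    simpa using Cardinal.lift_le.{w}.2 mk_compatibleSeq_le
  have h1 : Cardinal.mk PUnit.{w + 1} < Cardinal.aleph0.{w} := Cardinal.lt_aleph0_of_finite _
  exact ⟨h1, Formula.memL_imp h0.le ⟨hC, fun c => ⟨h1, hN, fun n => ⟨h1, trivial⟩⟩⟩ trivial⟩

end InfLogic

/-! ### Pure extension and cotorsion groups -/

/-- Every homomorphism to `A` from a subgroup with torsion-free quotient extends to the whole
group. -/
def HasPureExtension (A : Type w) [AddCommGroup A] : Prop :=
  ∀ (F : Type u) [AddCommGroup F] (K : Submodule ℤ F) [IsAddTorsionFree (F ⧸ K)]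
    (f : K →ₗ[ℤ] A), ∃ g : F →ₗ[ℤ] A, g ∘ₗ K.subtype = f

lemma HasPureExtension.of_equiv {A : Type w} {B : Type v'} [AddCommGroup A] [AddCommGroup B]
    (hA : HasPureExtension.{w, u} A) (e : A ≃+ B) : HasPureExtension.{v', u} B := by
  intro F _ K _ f
  obtain ⟨g, hg⟩ := hA F K (e.symm.toIntLinearEquiv.toLinearMap ∘ₗ f)
  refine ⟨e.toIntLinearEquiv.toLinearMap ∘ₗ g, ?_⟩
  rw [LinearMap.comp_assoc, hg]
  ext x
  simp

lemma IsAddTorsionFree.of_equiv {A : Type w} {B : Type v'} [AddCommGroup A] [AddCommGroup B]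
    [IsAddTorsionFree A] (e : A ≃+ B) : IsAddTorsionFree B :=
  Function.Injective.isAddTorsionFree e.symm.toAddMonoidHom e.symm.injective

/-- In a free presentation of `J`, each class in `Ext¹(J, A)` is the connecting image of a map from
the kernel to `A`; once this map extends to the free group, the class vanishes. -/
lemma HasPureExtension.isCotorsion {A : Type u} [AddCommGroup A]
    (hA : HasPureExtension.{u, u} A) : IsCotorsion A := by
  intro J _ _
  let π : (J →₀ ℤ) →ₗ[ℤ] J := Finsupp.linearCombination ℤ id
  have hπ : Function.Surjective π := fun x => ⟨Finsupp.single x 1, by simp [π]⟩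
  let K := LinearMap.ker π
  have : IsAddTorsionFree ((J →₀ ℤ) ⧸ K) :=
    .of_equiv (π.quotKerEquivOfSurjective hπ).symm.toAddEquiv
  let S : ShortComplex (ModuleCat.{u} ℤ) :=
    ShortComplex.mk (ModuleCat.ofHom K.subtype) (ModuleCat.ofHom π) (by ext x; exact x.2)
  have hS : S.ShortExact :=
    { exact := (ShortComplex.ShortExact.moduleCat_exact_iff_function_exact S).2
        (LinearMap.exact_subtype_ker_map π)
      mono_f := (ModuleCat.mono_iff_injective _).2 K.injective_subtype
      epi_g := (ModuleCat.epi_iff_surjective _).2 hπ }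
  have : Projective S.X₂ := (IsProjective.iff_projective (R := ℤ) (J →₀ ℤ)).1 inferInstance
  refine subsingleton_of_forall_eq 0 fun x => ?_
  obtain ⟨x₁, rfl⟩ := Abelian.Ext.contravariant_sequence_exact₃ hS _ x
    (Abelian.Ext.eq_zero_of_projective _) (add_comm 1 0)
  obtain ⟨f, rfl⟩ := Abelian.Ext.addEquiv₀.symm.surjective x₁
  obtain ⟨g, hg⟩ := hA _ K f.hom
  have : f = S.f ≫ ModuleCat.ofHom g := by ext1; exact hg.symm
  rw [this]
  simp [← Abelian.Ext.mk₀_comp_mk₀]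

/-- The obstruction to extending `f` lies in `Ext¹` of the torsion-free cokernel. -/
lemma IsCotorsion.exists_extension {A F F' : Type u} [AddCommGroup A] [AddCommGroup F]
    [AddCommGroup F'] [Module.Projective ℤ F] (hA : IsCotorsion A) (i : F' →ₗ[ℤ] F)
    (hi : Function.Injective i) [IsAddTorsionFree (F ⧸ LinearMap.range i)] (f : F' →ₗ[ℤ] A) :
    ∃ g : F →ₗ[ℤ] A, g ∘ₗ i = f := by
  let S : ShortComplex (ModuleCat.{u} ℤ) :=
    ShortComplex.mk (ModuleCat.ofHom i) (ModuleCat.ofHom (LinearMap.range i).mkQ)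
      (by ext x; simp)
  have hS : S.ShortExact :=
    { exact := (ShortComplex.ShortExact.moduleCat_exact_iff_function_exact S).2
        (LinearMap.exact_map_mkQ_range i)
      mono_f := (ModuleCat.mono_iff_injective _).2 hi
      epi_g := (ModuleCat.epi_iff_surjective _).2 (Submodule.mkQ_surjective _) }
  have := hA (F ⧸ LinearMap.range i)
  obtain ⟨x, hx⟩ := Abelian.Ext.contravariant_sequence_exact₁ hS _
    (Abelian.Ext.mk₀ (ModuleCat.ofHom f : S.X₁ ⟶ ModuleCat.of ℤ A)) (add_comm 1 0)
    (Subsingleton.elim (α := Abelian.Ext.{u} (ModuleCat.of ℤ (F ⧸ LinearMap.range i))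
      (ModuleCat.of ℤ A) 1) _ _)
  obtain ⟨g, rfl⟩ := Abelian.Ext.addEquiv₀.symm.surjective x
  refine ⟨g.hom, ?_⟩
  have h : S.f ≫ g = ModuleCat.ofHom f := by
    apply Abelian.Ext.addEquiv₀.symm.injective
    simpa using hx
  exact congrArg ModuleCat.Hom.hom h

/-- A finitely generated subgroup `Q` of the torsion-free quotient is free, so the projection has a
section `s` over it; `x ↦ f (x - s x)` is additive over `Q`. The value 0 elsewhere is irrelevant. -/
lemma exists_extension_of_fg {A : Type w} {F : Type u} [AddCommGroup A] [AddCommGroup F]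
    (K : Submodule ℤ F) [IsAddTorsionFree (F ⧸ K)] (f : K →ₗ[ℤ] A) (t : Set F) (ht : t.Finite) :
    ∃ r : F → A, (∀ k : K, r k = f k) ∧ ∀ x ∈ t, ∀ y ∈ t, r (x + y) = r x + r y := by
  classical
  let Q : Submodule ℤ (F ⧸ K) := Submodule.span ℤ (K.mkQ '' t)
  have : Module.Finite ℤ Q := .span_of_finite ℤ (ht.image _)
  obtain ⟨s, hs⟩ := Module.projective_lifting_property K.mkQ Q.subtype K.mkQ_surjective
  have hs' (x : F) (hx : K.mkQ x ∈ Q) : x - s ⟨K.mkQ x, hx⟩ ∈ K := by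
    refine (Submodule.Quotient.mk_eq_zero K).1 ?_
    change K.mkQ _ = 0
    rw [map_sub, sub_eq_zero]
    exact (LinearMap.congr_fun hs ⟨K.mkQ x, hx⟩).symm
  refine ⟨fun x => if hx : K.mkQ x ∈ Q then f ⟨_, hs' x hx⟩ else 0, fun k => ?_,
    fun x hx y hy => ?_⟩
  · have h0 : K.mkQ k = 0 := by simp
    have hk : K.mkQ k ∈ Q := h0 ▸ Q.zero_mem
    have : (⟨K.mkQ k, hk⟩ : Q) = 0 := Subtype.ext h0
    simp only [hk, dif_pos, this, map_zero, sub_zero]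
  · have hx' : K.mkQ x ∈ Q := Submodule.subset_span ⟨x, hx, rfl⟩
    have hy' : K.mkQ y ∈ Q := Submodule.subset_span ⟨y, hy, rfl⟩
    have hxy : K.mkQ (x + y) ∈ Q := by rw [map_add]; exact Q.add_mem hx' hy'
    simp only [hx', hy', hxy, dif_pos]
    rw [← map_add]
    congr 1
    ext
    have : (⟨K.mkQ (x + y), hxy⟩ : Q) = ⟨K.mkQ x, hx'⟩ + ⟨K.mkQ y, hy'⟩ :=
      Subtype.ext (map_add _ _ _)
    change x + y - s _ = (x - s _) + (y - s _)
    rw [this, map_add]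
    exact add_sub_add_comm _ _ _ _

/-- Compact Hausdorff groups are algebraically compact. -/
lemma HasPureExtension.of_compactSpace (A : Type w) [AddCommGroup A] [TopologicalSpace A]
    [IsTopologicalAddGroup A] [CompactSpace A] [T2Space A] : HasPureExtension.{w, u} A := by
  classical
  intro F _ K _ f
  -- By Tychonoff, the functions extending `f` form a compact set. Additivity is a family of closed
  -- conditions, any finitely many of which are satisfiable by the previous lemma.
  have hs : IsCompact {r : F → A | ∀ k : K, r k = f k} := by
    apply IsClosed.isCompact
    simp only [Set.ofPred_forall]
    exact isClosed_iInter fun k => isClosed_eq (continuous_apply _) continuous_const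
  obtain ⟨r, hr, hadd⟩ := hs.inter_iInter_nonempty
    (fun p : F × F => {r : F → A | r (p.1 + p.2) = r p.1 + r p.2})
    (fun p => isClosed_eq (continuous_apply _)
      ((continuous_apply p.1).fun_add (continuous_apply p.2)))
    (fun u => by
      obtain ⟨r, hr, hadd⟩ := exists_extension_of_fg K f
        (↑(u.image Prod.fst ∪ u.image Prod.snd)) (Finset.finite_toSet _)
      refine ⟨r, hr, ?_⟩
      simp only [Set.mem_iInter]
      intro p hp
      exact hadd _ (by simpa using .inl ⟨_, hp⟩) _ (by simpa using .inr ⟨_, hp⟩))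
  simp only [Set.mem_iInter, Prod.forall] at hadd
  refine ⟨(AddMonoidHom.mk' r hadd).toIntLinearMap, ?_⟩
  ext k
  exact hr k

lemma HasPureExtension.of_finite (A : Type w) [AddCommGroup A] [Finite A] :
    HasPureExtension.{w, u} A := by
  let : TopologicalSpace A := ⊥
  have : DiscreteTopology A := ⟨rfl⟩
  exact .of_compactSpace A

lemma HasPureExtension.of_divisible (A : Type u) [AddCommGroup A]
    (h : ∀ n : ℕ, n ≠ 0 → ∀ x : A, ∃ y, n • y = x) : HasPureExtension.{u, u} A := by
  intro F _ K _ f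
  let : DivisibleBy A ℕ := divisibleByOfSMulRightSurj A ℕ fun hn x => h _ hn x
  let : DivisibleBy A ℤ := AddGroup.divisibleByIntOfDivisibleByNat A
  have := (Module.Baer.of_divisible A).injective
  obtain ⟨g, hg⟩ := Module.Injective.out K.subtype K.injective_subtype f
  exact ⟨g, LinearMap.ext hg⟩

lemma IsAddTorsionFree.of_nsmul_eq_zero {A : Type w} [AddCommGroup A]
    (h : ∀ n : ℕ, n ≠ 0 → ∀ x : A, n • x = 0 → x = 0) : IsAddTorsionFree A :=
  ⟨fun n hn x y hxy => sub_eq_zero.1 <| h n hn _ <| by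
    rw [nsmul_sub, sub_eq_zero]
    exact hxy⟩

lemma isCotorsion_of_finite (A : Type u) [AddCommGroup A] [Finite A] : IsCotorsion A :=
  (HasPureExtension.of_finite A).isCotorsion

/-- Images of compact groups under homomorphisms with closed kernel are cotorsion. -/
lemma isCotorsion_range_of_isClosed_ker {A : Type v'} {G : Type u} [AddCommGroup A]
    [AddCommGroup G] [TopologicalSpace A] [IsTopologicalAddGroup A] [CompactSpace A] (φ : A →+ G)
    (hφ : IsClosed (φ.ker : Set A)) : IsCotorsion φ.range := by
  have : IsClosed (φ.ker : Set A) := hφ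
  have := HasPureExtension.of_compactSpace.{v', u} (A ⧸ φ.ker)
  exact (this.of_equiv (QuotientAddGroup.quotientKerEquivRange φ)).isCotorsion

/-! ### Cotorsion-free groups are torsion-free and reduced -/

namespace IsCotorsionFree

variable {G : Type u} [AddCommGroup G]

lemma eq_zero_of_nsmul_eq_zero (hG : IsCotorsionFree G) {n : ℕ} (hn : n ≠ 0) {x : G}
    (hx : n • x = 0) : x = 0 := by
  have hfin : Finite (AddSubgroup.zmultiples x) :=
    (finite_zmultiples (a := x)).2 (isOfFinAddOrder_iff_nsmul_eq_zero.2 ⟨n, hn.pos, hx⟩)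
  rw [← AddSubgroup.zmultiples_eq_bot]
  exact hG _ (isCotorsion_of_finite _)

lemma eq_zero_of_forall_dvd (hG : IsCotorsionFree G) {x : G}
    (hx : ∀ n : ℕ, n ≠ 0 → ∃ z : G, n • z = x) : x = 0 := by
  let D : AddSubgroup G :=
    { carrier := {x | ∀ n : ℕ, n ≠ 0 → ∃ z : G, n • z = x}
      zero_mem' := fun n _ => ⟨0, nsmul_zero n⟩
      add_mem' := fun {a b} ha hb n hn => by
        obtain ⟨z, rfl⟩ := ha n hn
        obtain ⟨t, rfl⟩ := hb n hn
        exact ⟨z + t, nsmul_add _ _ _⟩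
      neg_mem' := fun {a} ha n hn => by
        obtain ⟨z, rfl⟩ := ha n hn
        exact ⟨-z, neg_nsmul _ _⟩ }
  have hD : IsCotorsion D := by
    refine (HasPureExtension.of_divisible D ?_).isCotorsion
    rintro n hn ⟨y, hy⟩
    obtain ⟨z, rfl⟩ := hy n hn
    refine ⟨⟨z, fun m hm => ?_⟩, rfl⟩
    -- Torsion-freeness makes `n`-th roots unique, so the root `z` is itself divisible by every `m`.
    obtain ⟨t, ht⟩ := hy (n * m) (mul_ne_zero hn hm)
    refine ⟨t, sub_eq_zero.1 (hG.eq_zero_of_nsmul_eq_zero hn ?_)⟩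
    rw [nsmul_sub, ← mul_nsmul', ht, sub_self]
  have : x ∈ D := hx
  rwa [hG D hD] at this

end IsCotorsionFree

/-! ### Profinite multiples in a cotorsion-free group -/

instance (n : ℕ) : NeZero n.factorial := ⟨n.factorial_ne_zero⟩

/-- The profinite integers, as the inverse limit of the rings `ℤ/n!`. -/
def profiniteInt : AddSubgroup (∀ n : ℕ, ZMod n.factorial) where
  carrier := {c | ∀ n, ZMod.castHom (Nat.factorial_dvd_factorial n.le_succ) (ZMod n.factorial)
    (c (n + 1)) = c n}
  zero_mem' n := map_zero _
  add_mem' {a b} ha hb n := by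
    rw [Pi.add_apply, Pi.add_apply, map_add, ha n, hb n]
  neg_mem' {a} ha n := by
    rw [Pi.neg_apply, Pi.neg_apply, map_neg, ha n]

instance : CompactSpace profiniteInt := by
  refine isCompact_iff_compactSpace.1 (IsClosed.isCompact ?_)
  change IsClosed {c : ∀ n : ℕ, ZMod n.factorial | ∀ n,
    ZMod.castHom (Nat.factorial_dvd_factorial n.le_succ) (ZMod n.factorial) (c (n + 1)) = c n}
  simp only [Set.ofPred_forall]
  exact isClosed_iInter fun n =>
    isClosed_eq (continuous_of_discreteTopology.comp (continuous_apply (n + 1)))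
      (continuous_apply n)

/-- The natural representatives of a profinite integer. -/
def profiniteIntToSeq (c : profiniteInt) : InfLogic.CompatibleSeq :=
  ⟨fun n => (c.1 n).val, fun n => by
    rw [← ZMod.natCast_eq_natCast_iff, ZMod.natCast_zmod_val, ← c.2 n]
    conv_rhs => rw [← ZMod.natCast_zmod_val (c.1 (n + 1)), map_natCast]⟩

lemma IsCotorsionFree.eq_zero_of_profinite_multiples {G : Type u} [AddCommGroup G]
    (hG : IsCotorsionFree G) {x : G} (hx : ∀ c : InfLogic.CompatibleSeq, ∃ y : G, ∀ n, ∃ z : G,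
      y = c.1 n • x + n.factorial • z) : x = 0 := by
  let D (n : ℕ) : AddSubgroup G := (nsmulAddMonoidHom (α := G) n.factorial).range
  have hD (y : G) (hy : ∀ n, (y : G ⧸ D n) = 0) : y = 0 := by
    refine hG.eq_zero_of_forall_dvd fun n hn => ?_
    obtain ⟨z, hz⟩ := (QuotientAddGroup.eq_zero_iff y).1 (hy n)
    obtain ⟨k, hk⟩ := Nat.dvd_factorial hn.pos le_rfl
    exact ⟨k • z, by rw [← mul_nsmul', ← hk]; exact hz⟩
  let ψ (n : ℕ) : ZMod n.factorial →+ G ⧸ D n := ZMod.lift _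
    ⟨zmultiplesHom _ (x : G ⧸ D n), by
      rw [zmultiplesHom_apply, natCast_zsmul]
      exact (QuotientAddGroup.eq_zero_iff _).2 ⟨x, rfl⟩⟩
  have hψ (n k : ℕ) : ψ n k = ((k • x : G) : G ⧸ D n) := by
    have := ZMod.lift_coe n.factorial (A := G ⧸ D n) ⟨zmultiplesHom _ (x : G ⧸ D n), by
      rw [zmultiplesHom_apply, natCast_zsmul]
      exact (QuotientAddGroup.eq_zero_iff _).2 ⟨x, rfl⟩⟩ k
    rw [Int.cast_natCast] at this
    refine this.trans ?_
    simp
  have hex (c : profiniteInt) : ∃ y : G, ∀ n, (y : G ⧸ D n) = ψ n (c.1 n) := by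
    obtain ⟨y, hy⟩ := hx (profiniteIntToSeq c)
    refine ⟨y, fun n => ?_⟩
    obtain ⟨z, hz⟩ := hy n
    rw [← ZMod.natCast_zmod_val (c.1 n), hψ, hz, QuotientAddGroup.mk_add]
    rw [(QuotientAddGroup.eq_zero_iff (N := D n) (n.factorial • z)).2 ⟨z, rfl⟩, add_zero]
    rfl
  choose y hy using hex
  have huniq (a b : G) (hab : ∀ n, (a : G ⧸ D n) = b) : a = b :=
    sub_eq_zero.1 (hD _ fun n => by rw [QuotientAddGroup.mk_sub, hab, sub_self])
  let φ : profiniteInt →+ G := AddMonoidHom.mk' y fun a b => huniq _ _ fun n => by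
    rw [QuotientAddGroup.mk_add, hy, hy, hy, ← map_add]
    rfl
  -- Since the `D n` meet in zero, vanishing in `G` is tested modulo each `D n`, where it depends on
  -- one discrete coordinate of `c`.
  have hker : (φ.ker : Set profiniteInt) = ⋂ n, {c | ψ n (c.1 n) = 0} := by
    ext c
    simp only [SetLike.mem_coe, AddMonoidHom.mem_ker, Set.mem_iInter, Set.mem_ofPred_eq, ← hy]
    exact ⟨fun h n => by rw [show y c = 0 from h]; rfl, hD _⟩
  have hclosed : IsClosed (φ.ker : Set profiniteInt) := by
    rw [hker]
    refine isClosed_iInter fun n => ?_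
    exact (isClosed_discrete {a | ψ n a = 0}).preimage
      (f := fun c : profiniteInt => c.1 n) ((continuous_apply n).comp continuous_subtype_val)
  have hone : φ ⟨fun _ => 1, fun _ => map_one _⟩ = x := huniq _ _ fun n => by
    refine (hy _ n).trans ?_
    simpa using hψ n 1
  have hmem : x ∈ φ.range := ⟨_, hone⟩
  rwa [hG _ (isCotorsion_range_of_isClosed_ker φ hclosed)] at hmem

/-! ### Profinite multiples in a cotorsion group -/

/-- The endomorphism `eₙ ↦ eₙ - (n + 1) eₙ₊₁` of a free group; its cokernel is `ℚ`. -/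
noncomputable def factorialRelations : (ULift.{u} ℕ →₀ ℤ) →ₗ[ℤ] (ULift.{u} ℕ →₀ ℤ) :=
  Finsupp.linearCombination ℤ fun n =>
    Finsupp.single n 1 - Finsupp.single ⟨n.down + 1⟩ (n.down + 1 : ℤ)

lemma factorialRelations_apply_zero (a : ULift.{u} ℕ →₀ ℤ) :
    factorialRelations a ⟨0⟩ = a ⟨0⟩ := by
  induction a using Finsupp.induction_linear with
  | zero => simp
  | add f g hf hg => rw [map_add, Finsupp.add_apply, Finsupp.add_apply, hf, hg]
  | single n z => simp [factorialRelations, Finsupp.single_apply, ULift.ext_iff]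

lemma factorialRelations_apply_succ (a : ULift.{u} ℕ →₀ ℤ) (k : ℕ) :
    factorialRelations a ⟨k + 1⟩ = a ⟨k + 1⟩ - (k + 1) * a ⟨k⟩ := by
  induction a using Finsupp.induction_linear with
  | zero => simp
  | add f g hf hg =>
    simp only [map_add, Finsupp.add_apply, hf, hg]
    ring
  | single n z =>
    obtain ⟨n⟩ := n
    simp only [factorialRelations, Finsupp.linearCombination_single, Finsupp.smul_apply,
      Finsupp.sub_apply, Finsupp.single_apply, ULift.ext_iff, add_left_inj, smul_eq_mul]
    split_ifs <;> first | omega | (subst_vars; ring)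

lemma factorialRelations_injective : Function.Injective factorialRelations.{u} := by
  rw [← LinearMap.ker_eq_bot, LinearMap.ker_eq_bot']
  intro a ha
  ext ⟨k⟩
  induction k with
  | zero => rw [← factorialRelations_apply_zero, ha]
  | succ k ih =>
    have := factorialRelations_apply_succ a k
    rw [ha, ih] at this
    simpa using this.symm

instance : IsAddTorsionFree ((ULift.{u} ℕ →₀ ℤ) ⧸ LinearMap.range factorialRelations.{u}) := by
  refine .of_nsmul_eq_zero fun m hm q hq => ?_
  obtain ⟨f, rfl⟩ := Submodule.mkQ_surjective _ q
  rw [← map_nsmul, Submodule.mkQ_apply, Submodule.Quotient.mk_eq_zero] at hq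
  obtain ⟨a, ha⟩ := hq
  -- The recursion `a (k + 1) = m * f (k + 1) + (k + 1) * a k` propagates divisibility by `m`, so
  -- `a` can be divided by `m`.
  have hdvd (k : ℕ) : (m : ℤ) ∣ a ⟨k⟩ := by
    have h (j : ULift.{u} ℕ) : factorialRelations a j = m * f j := by rw [ha]; simp
    induction k with
    | zero => exact ⟨_, (factorialRelations_apply_zero a).symm.trans (h _)⟩
    | succ k ih =>
      have h' := factorialRelations_apply_succ a k
      rw [h, eq_sub_iff_add_eq] at h'
      rw [← h']
      exact dvd_add (dvd_mul_right _ _) (ih.mul_left _)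
  have hm' : (m : ℤ) ≠ 0 := by exact_mod_cast hm
  have hb : m • a.mapRange (· / (m : ℤ)) (Int.zero_ediv _) = a := by
    ext ⟨k⟩
    simpa using Int.mul_ediv_cancel' (hdvd k)
  rw [Submodule.mkQ_apply, Submodule.Quotient.mk_eq_zero]
  refine ⟨a.mapRange (· / (m : ℤ)) (Int.zero_ediv _), nsmul_right_injective hm ?_⟩
  change m • _ = m • _
  rw [← map_nsmul, hb, ha]

/-- With `c (n + 1) = c n + n! * d n`, the multiple is formally `c 0 • x + ∑ n! d n • x`. Its tails
`y n` must satisfy `y n = d n • x + (n + 1) • y (n + 1)`, which is the extension of `eₙ ↦ d n • x`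
along `factorialRelations`. -/
lemma IsCotorsion.exists_profinite_multiple {H : Type u} [AddCommGroup H] (hH : IsCotorsion H)
    (x : H) (c : InfLogic.CompatibleSeq) :
    ∃ y : H, ∀ n, ∃ z : H, y = c.1 n • x + n.factorial • z := by
  have hd (n : ℕ) : ∃ d : ℤ, (c.1 (n + 1) : ℤ) = c.1 n + n.factorial * d := by
    obtain ⟨d, hd⟩ := (Nat.modEq_iff_dvd.1 (c.2 n).symm)
    exact ⟨d, by rw [← hd]; ring⟩
  choose d hd using hd
  obtain ⟨g, hg⟩ := hH.exists_extension factorialRelations.{u} factorialRelations_injective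
    (Finsupp.linearCombination ℤ fun n : ULift.{u} ℕ => d n.down • x)
  let y (n : ℕ) : H := g (Finsupp.single ⟨n⟩ 1)
  have hy (n : ℕ) : y n = d n • x + (n + 1 : ℤ) • y (n + 1) := by
    have := LinearMap.congr_fun hg (Finsupp.single ⟨n⟩ 1)
    rw [LinearMap.comp_apply, Finsupp.linearCombination_single, factorialRelations,
      Finsupp.linearCombination_single, one_smul, one_smul, map_sub, sub_eq_iff_eq_add] at this
    rw [show y n = _ from this, ← map_smul, Finsupp.smul_single, smul_eq_mul, mul_one]
  refine ⟨y 0 + c.1 0 • x, fun n => ⟨y n, ?_⟩⟩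
  induction n with
  | zero => rw [Nat.factorial_zero, one_nsmul, add_comm]
  | succ n ih =>
    rw [ih, hy n, ← natCast_zsmul x (c.1 (n + 1)), hd n, ← natCast_zsmul, ← natCast_zsmul,
      ← natCast_zsmul, Nat.factorial_succ]
    push_cast
    module

/-! ### Definability -/

lemma isCotorsionFree_iff (G : Type u) [AddCommGroup G] : IsCotorsionFree G ↔
    InfLogic.cotorsionFreeSentence.{w}.Holds G := by
  rw [InfLogic.holds_cotorsionFreeSentence]
  constructor
  · exact fun hG x hx => hG.eq_zero_of_profinite_multiples hx
  · intro h H hH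
    refine (AddSubgroup.eq_bot_iff_forall H).2 fun x hx => h x fun c => ?_
    obtain ⟨y, hy⟩ := hH.exists_profinite_multiple ⟨x, hx⟩ c
    refine ⟨y, fun n => ?_⟩
    obtain ⟨z, hz⟩ := hy n
    exact ⟨z, congrArg Subtype.val hz⟩

theorem corollary2p2 :
    InfLogic.IsDefinable.{w, u} (Order.succ (2 ^ Cardinal.aleph0.{w})) Cardinal.aleph0.{w}
        (fun (G : Type u) [AddCommGroup G] => IsCotorsionFree G) ∧
      InfLogic.IsDefinableInfty.{w, u} Cardinal.aleph0.{w}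
        (fun (G : Type u) [AddCommGroup G] => IsCotorsionFree G) := by
  have h0 : Cardinal.aleph0.{w} ≤ Order.succ (2 ^ Cardinal.aleph0.{w}) :=
    ((Cardinal.cantor _).trans (Order.lt_succ _)).le
  exact ⟨⟨_, InfLogic.memL_cotorsionFreeSentence, fun G _ => isCotorsionFree_iff G⟩,
    ⟨_, ⟨_, h0, h0, InfLogic.memL_cotorsionFreeSentence⟩, fun G _ => isCotorsionFree_iff G⟩⟩
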